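/- Let $E$ be a real Banach space with dual $E^*$ that is uniformly convex and $2$-uniformly smooth, the latter meaning that there is a $c>0$ such that for all $\tau>0$ $$\sup\left\{\frac{\|u+\tau v\|+\|u-\tau v\|}{2}-1 \;\middle|\; u,v\in E,\ \|u\|=\|v\|=1\right\}\le c\,\tau^2 .$$ Let $j:E\to E^*$ be its normalized duality mapping, i.e. for each $x\in E$, $j(x)$ is the (in such a space unique) functional with $j(x)(x)=\|x\|^2$ and $\|j(x)\|=\|x\|$. Let $d\ge 1$ be a constant such that for all $x,y\in E$ $$\|x+y\|^2\le\|x\|^2+2j(x)(y)+d\|y\|^2 .$$ Let $C\subseteq E$ be closed and convex, let $k\in(0,1)$, and let $T:C\to C$ be a $k$-strict pseudocontraction, i.e. for all $x,y\in C$ $$j(x-y)\big((x-Tx)-(y-Ty)\big)\ge\frac{1-k}{2}\,\|(x-Tx)-(y-Ty)\|^2 ,$$ and suppose that $T$ has a fixed point. Let $x\in C$ and let $(t_n)_{n\in\mathbb N}\subseteq\left(0,\frac{1-k}{d}\right)$ be such that $$\sum_{n=0}^\infty t_n\left(\frac{1-k}{d}-t_n\right)=\infty .$$ Then the Mann iteration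 $x_0:=x$, $x_{n+1}:=t_nTx_n+(1-t_n)x_n$ converges weakly to a fixed point of $T$. -/

import Mathlib

open Filter Topology

noncomputable section

/-- The modulus of smoothness of `E`:
`ρ_E(τ) = sup {(‖u + τ v‖ + ‖u - τ v‖) / 2 - 1 | ‖u‖ = ‖v‖ = 1}`. -/
def modulusOfSmoothness (E : Type*) [NormedAddCommGroup E] [NormedSpace ℝ E] (τ : ℝ) : ℝ :=
  sSup {r : ℝ | ∃ u v : E, ‖u‖ = 1 ∧ ‖v‖ = 1 ∧ r = (‖u + τ • v‖ + ‖u - τ • v‖) / 2 - 1}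

/-- `E` is 2-uniformly smooth: `ρ_E(τ) ≤ c τ²` for all `τ > 0`, for some constant `c > 0`. -/
def IsTwoUniformlySmooth (E : Type*) [NormedAddCommGroup E] [NormedSpace ℝ E] : Prop :=
  ∃ c : ℝ, 0 < c ∧ ∀ τ : ℝ, 0 < τ → modulusOfSmoothness E τ ≤ c * τ ^ 2

/-- The (set-valued) normalized duality mapping `J : E → 2^{E*}`. -/
def normalizedDuality {E : Type*} [NormedAddCommGroup E] [NormedSpace ℝ E] (x : E) :
    Set (StrongDual ℝ E) :=
  {f | f x = ‖x‖ ^ 2 ∧ ‖f‖ = ‖x‖}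

/-- By Hahn-Banach, `J x` is never empty. -/
theorem normalizedDuality_nonempty {E : Type*} [NormedAddCommGroup E] [NormedSpace ℝ E] (x : E) :
    (normalizedDuality x).Nonempty := by
  by_cases hx : x = 0
  · exact ⟨0, by simp [normalizedDuality, hx]⟩
  · obtain ⟨g, hg, hgx⟩ := exists_dual_vector ℝ x (norm_ne_zero_iff.mpr hx)
    refine ⟨‖x‖ • g, ?_, ?_⟩
    · simp only [smul_apply, hgx, smul_eq_mul]
      simp [sq]
    · rw [norm_smul, hg]; simp

/-- The section `j : E → E*` of the normalized duality mapping; in a 2-uniformly smooth space it is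
the only one, see `normalizedDuality_eq_singleton`. -/
def dualityMap {E : Type*} [NormedAddCommGroup E] [NormedSpace ℝ E] (x : E) : StrongDual ℝ E :=
  (normalizedDuality_nonempty x).choose

theorem dualityMap_mem {E : Type*} [NormedAddCommGroup E] [NormedSpace ℝ E] (x : E) :
    dualityMap x ∈ normalizedDuality x :=
  (normalizedDuality_nonempty x).choose_spec

/-- In a 2-uniformly smooth space the normalized duality mapping is single-valued, so that
`dualityMap` does not depend on a choice. -/
theorem normalizedDuality_eq_singleton {E : Type*} [NormedAddCommGroup E] [NormedSpace ℝ E]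
    (hE : IsTwoUniformlySmooth E) (x : E) : normalizedDuality x = {dualityMap x} := by
  obtain ⟨c, hc, hρ⟩ := hE
  by_cases hx : x = 0
  · subst hx
    ext f
    have h0 := (dualityMap_mem (0 : E)).2
    simp only [norm_zero, norm_eq_zero] at h0
    simp [normalizedDuality, h0]
  have hxn : 0 < ‖x‖ := norm_pos_iff.mpr hx
  have key : ∀ f ∈ normalizedDuality x, ∀ g ∈ normalizedDuality x, ∀ v : E, ‖v‖ = 1 →
      f v ≤ g v := by
    intro f hf g hg v hv
    by_contra hlt
    rw [not_le] at hlt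
    have step : ∀ h : ℝ, 0 < h → f v - g v ≤ 2 * ‖x‖ * c * h := by
      intro h hh
      have hu : ‖‖x‖⁻¹ • x‖ = 1 := by
        rw [norm_smul, norm_inv, norm_norm, inv_mul_cancel₀ hxn.ne']
      have hb : (‖‖x‖⁻¹ • x + h • v‖ + ‖‖x‖⁻¹ • x - h • v‖) / 2 - 1 ≤ c * h ^ 2 := by
        refine le_trans (le_csSup (a := _) ?_ ?_) (hρ h hh)
        swap
        · exact ⟨_, _, hu, hv, rfl⟩
        refine ⟨h, ?_⟩
        rintro _ ⟨u, w, hu, hw, rfl⟩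
        have h1 := norm_add_le u (h • w)
        have h2 := norm_sub_le u (h • w)
        rw [norm_smul, hu, hw, Real.norm_of_nonneg hh.le] at h1 h2
        linarith
      have e1 := (le_abs_self _).trans (f.le_opNorm (‖x‖⁻¹ • x + h • v))
      have e2 := (le_abs_self _).trans (g.le_opNorm (‖x‖⁻¹ • x - h • v))
      simp only [map_add, map_sub, map_smul, smul_eq_mul, hf.1, hf.2, hg.1, hg.2] at e1 e2
      have e3 : ‖x‖⁻¹ * ‖x‖ ^ 2 = ‖x‖ := by field_simp
      rw [e3] at e1 e2
      have e4 : h * (f v - g v) ≤ h * (2 * ‖x‖ * c * h) := by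
        have := mul_le_mul_of_nonneg_left hb hxn.le
        nlinarith
      exact le_of_mul_le_mul_left e4 hh
    have hp : 0 < 2 * ‖x‖ * c := by positivity
    have := step ((f v - g v) / (2 * (2 * ‖x‖ * c))) (by
      have : 0 < f v - g v := by linarith
      positivity)
    have e : 2 * ‖x‖ * c * ((f v - g v) / (2 * (2 * ‖x‖ * c))) = (f v - g v) / 2 := by
      field_simp
    rw [e] at this
    linarith
  refine Set.eq_singleton_iff_unique_mem.mpr ⟨dualityMap_mem x, fun f hf => ?_⟩
  ext v
  by_cases hv : v = 0
  · simp [hv]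
  have hvn : ‖v‖ ≠ 0 := norm_ne_zero_iff.mpr hv
  have hw : ‖‖v‖⁻¹ • v‖ = 1 := by
    rw [norm_smul, norm_inv, norm_norm, inv_mul_cancel₀ hvn]
  have := le_antisymm (key f hf _ (dualityMap_mem x) _ hw) (key _ (dualityMap_mem x) f hf _ hw)
  simpa [hvn] using this

/-- `T` is a `k`-strict pseudocontraction on `C`. Only the values of `T` on `C` matter. -/
def IsStrictPseudocontractionOn {E : Type*} [NormedAddCommGroup E] [NormedSpace ℝ E]
    (k : ℝ) (T : E → E) (C : Set E) : Prop :=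
  ∀ x ∈ C, ∀ y ∈ C,
    (1 - k) / 2 * ‖(x - T x) - (y - T y)‖ ^ 2 ≤ dualityMap (x - y) ((x - T x) - (y - T y))

/-- The Mann iteration `x₀ = x`, `xₙ₊₁ = tₙ T xₙ + (1 - tₙ) xₙ`. -/
def mannIteration {E : Type*} [NormedAddCommGroup E] [NormedSpace ℝ E]
    (T : E → E) (t : ℕ → ℝ) (x : E) : ℕ → E
  | 0 => x
  | n + 1 => t n • T (mannIteration T t x n) + (1 - t n) • mannIteration T t x n

end

/-!
Write `b = (1 - k) / d` and `S = b T + (1 - b) I`. Expanding `‖(x - y) - t ((x - T x) - (y - T y))‖²`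
with the smoothness inequality and the pseudocontraction inequality
(`IsStrictPseudocontractionOn.norm_relaxation_sub_sq_le`) shows that `t T + (1 - t) I` is nonexpansive
for `0 ≤ t ≤ b`, and that each Mann step decreases the squared distance to a fixed point by at least
`d tₙ (b - tₙ) ‖xₙ - T xₙ‖²`. Since the Mann iteration of `T` is a Krasnoselskii-Mann iteration of the
nonexpansive map `S`, the residuals `‖xₙ - T xₙ‖` also decrease; as `∑ tₙ (b - tₙ) = ∞`, they tend to
`0` (`tendsto_norm_mannIteration_sub_apply`).

What remains is a theorem of Reich's type on orbits under nonexpansive maps with common fixed points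
(`IsNonexpansiveOrbit.exists_tendsto_weak`). It has three parts.

* *Existence of weak limits.* In a complete uniformly convex space a downward directed family of
  closed convex sets that all meet one fixed ball has a common point
  (`nonempty_iInter_of_directed_convex`). Applied to the closed convex hulls of the sets
  `{xₙ | n ∈ A}`, for `A` in an ultrafilter, it yields a point to which `x` converges weakly along the
  ultrafilter. This stands in for reflexivity and weak compactness, and it places the limit in all
  those hulls.
* *Weak limits are fixed points* (`apply_eq_self_of_mem_closure_convexHull`). By uniform convexity the
  midpoint of two almost fixed points is almost fixed, hence so is the mean of `2 ^ m` almost fixed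
  points. By a greedy choice, driven by the smoothness inequality, every point of a convex hull is
  approximated by such means with `m` depending on the accuracy only. Hence the convex hull of a set
  of almost fixed points consists of almost fixed points.
* *Weak limits are unique* (`IsNonexpansiveOrbit.cauchySeq_dualityMap`). For common fixed points `p`
  and `q` and small `l > 0`, the sequence `‖l xₙ + (1 - l) p - q‖` converges, because by uniform
  convexity the maps that move the orbit are almost affine on the segments from `xₙ` to `p`. The
  derivative of `‖·‖²` at `p - q` being `2 j(p - q)`, uniformly on bounded sets, `j(p - q)(xₙ - p)`
  converges as well. If `p` and `q` are limits along two ultrafilters, then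
  `0 = j(p - q)(q - p) = -‖p - q‖²`.
-/

/-! ### Uniform convexity and weak limits along ultrafilters -/

section UniformConvexity

variable {E : Type*} [NormedAddCommGroup E] [NormedSpace ℝ E] [UniformConvexSpace E]

/-- Uniform convexity with one gain `η` for all balls of radius at most `R`. Small radii do no harm,
since `ε ≤ ‖a - b‖` forces `ε / 2 ≤ r`. -/
theorem exists_forall_norm_add_le_two_mul_sub_of_le {ε : ℝ} (hε : 0 < ε) (R : ℝ) :
    ∃ η > 0, ∀ r ≤ R, ∀ a b : E, ‖a‖ ≤ r → ‖b‖ ≤ r → ε ≤ ‖a - b‖ → ‖a + b‖ ≤ 2 * r - η := by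
  have hR' : 0 < max R 1 := lt_max_of_lt_right one_pos
  obtain ⟨δ, hδ, h⟩ := exists_forall_closed_ball_dist_add_le_two_sub E (div_pos hε hR')
  refine ⟨δ * (ε / 2), by positivity, fun r hr a b ha hb hab => ?_⟩
  have hr' : ε / 2 ≤ r := by linarith [norm_sub_le a b]
  have hr0 : 0 < r := by linarith
  have hsc : ∀ v : E, ‖r⁻¹ • v‖ = ‖v‖ / r := fun v => by
    rw [norm_smul_of_nonneg (inv_nonneg.2 hr0.le), div_eq_inv_mul]
  have key := @h (r⁻¹ • a) (by rw [hsc]; exact (div_le_one hr0).2 ha)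
    (r⁻¹ • b) (by rw [hsc]; exact (div_le_one hr0).2 hb) (by
      rw [← smul_sub, hsc]
      exact (div_le_div_of_nonneg_left hε.le hr0 (hr.trans (le_max_left _ _))).trans
        (div_le_div_of_nonneg_right hab hr0.le))
  rw [← smul_add, hsc, div_le_iff₀ hr0] at key
  nlinarith

theorem exists_forall_norm_convexCombo_le_sub {ε : ℝ} (hε : 0 < ε) (R : ℝ) {l : ℝ} (hl : 0 < l)
    (hl2 : l ≤ 1 / 2) :
    ∃ η > 0, ∀ r ≤ R, ∀ a b : E, ‖a‖ ≤ r → ‖b‖ ≤ r → ε ≤ ‖a - b‖ →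
      ‖l • a + (1 - l) • b‖ ≤ r - η := by
  obtain ⟨η, hη, h⟩ := exists_forall_norm_add_le_two_mul_sub_of_le (E := E) hε R
  refine ⟨l * η, by positivity, fun r hr a b ha hb hab => ?_⟩
  have e : l • a + (1 - l) • b = l • (a + b) + (1 - 2 * l) • b := by module
  calc ‖l • a + (1 - l) • b‖ ≤ l * ‖a + b‖ + (1 - 2 * l) * ‖b‖ := by
        rw [e]
        refine (norm_add_le _ _).trans (le_of_eq ?_)
        rw [norm_smul_of_nonneg hl.le, norm_smul_of_nonneg (by linarith)]
    _ ≤ l * (2 * r - η) + (1 - 2 * l) * r := by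
        gcongr
        · exact h r hr a b ha hb hab
        · linarith
    _ = r - l * η := by ring

/-- Take for `r` the supremum of the distances from the origin to the sets `K i`: every `K i` comes
within distance `r` of the origin, and for a suitable `i` the points of `K i` that nearly do so are
close together. -/
theorem exists_radius_of_directed_convex {ι : Type*} [Nonempty ι] {K : ι → Set E}
    (hconv : ∀ i, Convex ℝ (K i)) {M : ℝ} (hM : ∀ i, ∃ y ∈ K i, ‖y‖ ≤ M) :
    ∃ r : ℝ, (∀ i, ∀ η > 0, ∃ y ∈ K i, ‖y‖ ≤ r + η) ∧ ∀ ε > 0, ∃ i, ∃ η > 0,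
      ∀ y ∈ K i, ∀ z ∈ K i, ‖y‖ ≤ r + η → ‖z‖ ≤ r + η → ‖y - z‖ < ε := by
  -- `P` is the set of radii of balls about the origin that meet every `K i`.
  set P : Set ℝ := {s | ∀ i, ∃ y ∈ K i, ‖y‖ ≤ s} with hP
  have hPne : P.Nonempty := ⟨M, hM⟩
  have hPbdd : BddBelow P := ⟨0, fun s hs => by
    obtain ⟨y, -, hy⟩ := hs (Classical.arbitrary ι)
    exact (norm_nonneg y).trans hy⟩
  refine ⟨sInf P, fun i η hη => ?_, fun ε hε => ?_⟩
  · obtain ⟨s, hs, hsr⟩ := exists_lt_of_csInf_lt hPne (show sInf P < sInf P + η by linarith)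
    exact (hs i).imp fun y hy => ⟨hy.1, hy.2.trans hsr.le⟩
  · obtain ⟨η, hη, h⟩ := exists_forall_norm_add_le_two_mul_sub_of_le (E := E) hε (sInf P + 1)
    obtain ⟨i, hi⟩ : ∃ i, ∀ y ∈ K i, sInf P - η / 4 < ‖y‖ := by
      by_contra! hcon
      have : sInf P ≤ sInf P - η / 4 := csInf_le hPbdd hcon
      linarith
    refine ⟨i, min 1 (η / 4), by positivity, fun y hy z hz hyr hzr => ?_⟩
    by_contra! hyz
    have h1 := h _ (by gcongr; exact min_le_left _ _) y z hyr hzr hyz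
    -- The midpoint lies in `K i` and would be shorter than `K i` allows.
    have h2 := hi _ (hconv i hy hz (by norm_num : (0 : ℝ) ≤ 1 / 2)
      (by norm_num : (0 : ℝ) ≤ 1 / 2) (by norm_num))
    rw [← smul_add, norm_smul_of_nonneg (by norm_num)] at h2
    have := min_le_right 1 (η / 4)
    linarith

/-- The substitute for weak compactness of bounded closed convex sets: Cantor's intersection theorem
for nearly shortest points. -/
theorem nonempty_iInter_of_directed_convex [CompleteSpace E] {ι : Type*} [Nonempty ι]
    {K : ι → Set E} (hdir : Directed (· ⊇ ·) K) (hconv : ∀ i, Convex ℝ (K i))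
    (hclosed : ∀ i, IsClosed (K i)) {M : ℝ} (hM : ∀ i, ∃ y ∈ K i, ‖y‖ ≤ M) :
    (⋂ i, K i).Nonempty := by
  obtain ⟨r, hne, hsmall⟩ := exists_radius_of_directed_convex hconv hM
  have : Nonempty {η : ℝ // 0 < η} := ⟨⟨1, one_pos⟩⟩
  -- The traces of the `K i` on balls of radius slightly above `r` form a Cauchy filter basis.
  let Q : ι × {η : ℝ // 0 < η} → Set E := fun i => K i.1 ∩ Metric.closedBall 0 (r + i.2.1)
  have hQmem : ∀ i, Q i ∈ ⨅ i, 𝓟 (Q i) := fun i =>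
    Filter.mem_iInf_of_mem i (Filter.mem_principal_self _)
  have hQne : (⨅ i, 𝓟 (Q i)).NeBot := by
    refine Filter.iInf_neBot_of_directed ?_ fun i => ?_
    · intro i j
      obtain ⟨k, hki, hkj⟩ := hdir i.1 j.1
      refine ⟨(k, ⟨min i.2.1 j.2.1, lt_min i.2.2 j.2.2⟩), ?_, ?_⟩
      · refine Filter.principal_mono.2 (Set.inter_subset_inter hki
          (Metric.closedBall_subset_closedBall ?_))
        exact (add_le_add_iff_left r).2 (min_le_left _ _)
      · refine Filter.principal_mono.2 (Set.inter_subset_inter hkj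
          (Metric.closedBall_subset_closedBall ?_))
        exact (add_le_add_iff_left r).2 (min_le_right _ _)
    · obtain ⟨y, hy, hyr⟩ := hne i.1 i.2.1 i.2.2
      exact Filter.principal_neBot_iff.2 ⟨y, hy, mem_closedBall_zero_iff.2 hyr⟩
  have hcauchy : Cauchy (⨅ i, 𝓟 (Q i)) := Metric.cauchy_iff.2 ⟨hQne, fun ε hε => by
    obtain ⟨i, η, hη, h⟩ := hsmall ε hε
    refine ⟨_, hQmem (i, ⟨η, hη⟩), fun y hy z hz => ?_⟩
    rw [dist_eq_norm]
    exact h y hy.1 z hz.1 (mem_closedBall_zero_iff.1 hy.2) (mem_closedBall_zero_iff.1 hz.2)⟩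
  obtain ⟨p, hp⟩ := CompleteSpace.complete hcauchy
  refine ⟨p, Set.mem_iInter.2 fun i => ?_⟩
  have hmem : K i ∈ ⨅ i, 𝓟 (Q i) :=
    Filter.mem_of_superset (hQmem (i, ⟨1, one_pos⟩)) Set.inter_subset_left
  exact isClosed_iff_clusterPt.1 (hclosed i) p
    (hQne.mono (le_inf hp (Filter.le_principal_iff.2 hmem)))

theorem exists_forall_mem_closure_convexHull_image [CompleteSpace E] {ι : Type*} (l : Filter ι)
    [l.NeBot] {x : ι → E} {M : ℝ} (hM : ∀ i, ‖x i‖ ≤ M) :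
    ∃ p, ∀ A ∈ l, p ∈ closure (convexHull ℝ (x '' A)) := by
  have : Nonempty {A // A ∈ l} := ⟨⟨Set.univ, Filter.univ_mem⟩⟩
  obtain ⟨p, hp⟩ := nonempty_iInter_of_directed_convex
    (K := fun A : {A // A ∈ l} => closure (convexHull ℝ (x '' A.1))) (M := M)
    (fun A B => ⟨⟨A.1 ∩ B.1, Filter.inter_mem A.2 B.2⟩,
      closure_mono (convexHull_mono (Set.image_mono Set.inter_subset_left)),
      closure_mono (convexHull_mono (Set.image_mono Set.inter_subset_right))⟩)
    (fun A => (convex_convexHull ℝ _).closure) (fun A => isClosed_closure) (fun A => by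
      obtain ⟨i, hi⟩ := l.nonempty_of_mem A.2
      exact ⟨x i, subset_closure (subset_convexHull ℝ _ ⟨i, hi, rfl⟩), hM i⟩)
  exact ⟨p, fun A hA => Set.mem_iInter.1 hp ⟨A, hA⟩⟩

end UniformConvexity

/-- If `f (x i) ≥ f p + ε` held for all `i` in some `A ∈ U`, the closed half-space `f ≥ f p + ε` would
contain `p`. -/
theorem tendsto_of_mem_closure_convexHull_image {E : Type*} [NormedAddCommGroup E]
    [NormedSpace ℝ E] {ι : Type*} (U : Ultrafilter ι) {x : ι → E} {p : E}
    (hp : ∀ A ∈ U, p ∈ closure (convexHull ℝ (x '' A))) (f : StrongDual ℝ E) :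
    Tendsto (fun i => f (x i)) U (𝓝 (f p)) := by
  have key : ∀ (g : StrongDual ℝ E) (ε : ℝ), 0 < ε → ∀ᶠ i in U, g (x i) < g p + ε := by
    intro g ε hε
    by_contra hcon
    have hA : {i | g p + ε ≤ g (x i)} ∈ U := by
      filter_upwards [Ultrafilter.eventually_not.2 hcon] with i hi
      exact not_lt.1 hi
    have hsub : closure (convexHull ℝ (x '' {i | g p + ε ≤ g (x i)})) ⊆ {y | g p + ε ≤ g y} := by
      refine closure_minimal (convexHull_min ?_ ?_) (isClosed_le continuous_const g.continuous)
      · rintro _ ⟨i, hi, rfl⟩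
        exact hi
      · exact convex_halfSpace_ge g.toLinearMap.isLinear _
    have : g p + ε ≤ g p := hsub (hp _ hA)
    linarith
  rw [Metric.tendsto_nhds]
  intro ε hε
  filter_upwards [key f ε hε, key (-f) ε hε] with i h1 h2
  simp only [neg_apply] at h2
  rw [Real.dist_eq, abs_lt]
  constructor <;> linarith

/-! ### Almost fixed points of nonexpansive maps -/

section Nonexpansive

theorem LipschitzOnWith.norm_sub_le_of_one {E : Type*} [NormedAddCommGroup E] {S : E → E}
    {K : Set E} (hS : LipschitzOnWith 1 S K)
    {x y : E} (hx : x ∈ K) (hy : y ∈ K) : ‖S x - S y‖ ≤ ‖x - y‖ := by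
  simpa using hS.norm_sub_le hx hy

variable {E : Type*} [NormedAddCommGroup E] [NormedSpace ℝ E]

/-- The midpoint `m` of two almost fixed points `x`, `y` is almost fixed: `S m` is nearly within
`‖x - y‖ / 2` of both `x` and `y`, which by uniform convexity only points near `m` are. -/
theorem exists_forall_norm_midpoint_sub_le [UniformConvexSpace E] {ε : ℝ} (hε : 0 < ε) (R : ℝ) :
    ∃ δ > 0, ∀ (K : Set E) (S : E → E), Convex ℝ K → LipschitzOnWith 1 S K →
      ∀ x ∈ K, ∀ y ∈ K, ‖x - y‖ ≤ R → ‖x - S x‖ ≤ δ → ‖y - S y‖ ≤ δ →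
        ‖(2⁻¹ : ℝ) • (x + y) - S ((2⁻¹ : ℝ) • (x + y))‖ ≤ ε := by
  obtain ⟨η, hη, h⟩ := exists_forall_norm_add_le_two_mul_sub_of_le (E := E)
    (show 0 < 2 * ε by positivity) (R / 2 + 1)
  refine ⟨min 1 (η / 4), by positivity, fun K S hK hS x hx y hy hR hxS hyS => ?_⟩
  set m := (2⁻¹ : ℝ) • (x + y) with hm
  set δ := min 1 (η / 4) with hδ
  have hδ1 : δ ≤ 1 := min_le_left _ _
  have hδη : δ ≤ η / 4 := min_le_right _ _
  have hmK : m ∈ K := by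
    rw [hm, smul_add]
    exact hK hx hy (by norm_num) (by norm_num) (by norm_num)
  have half : ∀ v : E, ‖(2⁻¹ : ℝ) • v‖ = ‖v‖ / 2 := fun v => by
    rw [norm_smul_of_nonneg (by norm_num)]; ring
  have h1 : ‖x - S m‖ ≤ ‖x - y‖ / 2 + δ := by
    have e : x - m = (2⁻¹ : ℝ) • (x - y) := by rw [hm]; module
    have := hS.norm_sub_le_of_one hx hmK
    rw [e, half] at this
    linarith [norm_sub_le_norm_sub_add_norm_sub x (S x) (S m)]
  have h2 : ‖S m - y‖ ≤ ‖x - y‖ / 2 + δ := by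
    have e : m - y = (2⁻¹ : ℝ) • (x - y) := by rw [hm]; module
    have := hS.norm_sub_le_of_one hmK hy
    rw [e, half] at this
    linarith [norm_sub_le_norm_sub_add_norm_sub (S m) (S y) y, norm_sub_rev (S y) y]
  by_contra! hcon
  have e1 : x - S m - (S m - y) = (2 : ℝ) • (m - S m) := by rw [hm]; module
  have h3 := h _ (by linarith) _ _ h1 h2 (by
    rw [e1, norm_smul_of_nonneg (by norm_num)]; linarith)
  rw [sub_add_sub_cancel] at h3
  linarith

theorem exists_forall_norm_dyadicMean_sub_le [UniformConvexSpace E] (R : ℝ) (m : ℕ) {ε : ℝ}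
    (hε : 0 < ε) :
    ∃ δ > 0, ∀ (K : Set E) (S : E → E), Convex ℝ K → LipschitzOnWith 1 S K →
      (∀ x ∈ K, ∀ y ∈ K, ‖x - y‖ ≤ R) → ∀ y : ℕ → E, (∀ i, y i ∈ K) →
      (∀ i, ‖y i - S (y i)‖ ≤ δ) →
        ((2 ^ m : ℝ)⁻¹ • ∑ i ∈ Finset.range (2 ^ m), y i) ∈ K ∧
        ‖((2 ^ m : ℝ)⁻¹ • ∑ i ∈ Finset.range (2 ^ m), y i) -
          S ((2 ^ m : ℝ)⁻¹ • ∑ i ∈ Finset.range (2 ^ m), y i)‖ ≤ ε := by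
  induction m generalizing ε with
  | zero => exact ⟨ε, hε, fun K S _ _ _ y hy hyS => by simpa using ⟨hy 0, hyS 0⟩⟩
  | succ m ih =>
    obtain ⟨δ₁, hδ₁, hmid⟩ := exists_forall_norm_midpoint_sub_le (E := E) hε R
    obtain ⟨δ, hδ, h⟩ := ih hδ₁
    refine ⟨δ, hδ, fun K S hK hS hKR y hy hyS => ?_⟩
    obtain ⟨ha, ha'⟩ := h K S hK hS hKR y hy hyS
    obtain ⟨hb, hb'⟩ := h K S hK hS hKR (fun i => y (2 ^ m + i)) (fun i => hy _) (fun i => hyS _)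
    have e : ((2 ^ (m + 1) : ℝ)⁻¹ • ∑ i ∈ Finset.range (2 ^ (m + 1)), y i) =
        (2⁻¹ : ℝ) • ((2 ^ m : ℝ)⁻¹ • ∑ i ∈ Finset.range (2 ^ m), y i +
          (2 ^ m : ℝ)⁻¹ • ∑ i ∈ Finset.range (2 ^ m), y (2 ^ m + i)) := by
      rw [show 2 ^ (m + 1) = 2 ^ m + 2 ^ m by ring, Finset.sum_range_add, ← smul_add, smul_smul,
        pow_succ, mul_inv_rev]
    rw [e]
    refine ⟨?_, hmid K S hK hS _ ha _ hb (hKR _ ha _ hb) ha' hb'⟩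
    rw [smul_add]
    exact hK ha hb (by norm_num) (by norm_num) (by norm_num)

/-- Greedy approximation of a point of a convex hull by means of points of the set. Given the partial
sum `s`, some `x ∈ F` has `j(s)(x - z) ≤ 0`, so that adding `x - z` increases the squared norm by at
most `d * D ^ 2`. -/
theorem exists_seq_norm_sum_sub_sq_le {d D : ℝ}
    (hd : ∀ x y : E, ‖x + y‖ ^ 2 ≤ ‖x‖ ^ 2 + 2 * dualityMap x y + d * ‖y‖ ^ 2) (hd0 : 0 ≤ d)
    {F : Set E} {z : E} (hz : z ∈ convexHull ℝ F) (hD : ∀ x ∈ F, ‖x - z‖ ≤ D) :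
    ∃ y : ℕ → E, (∀ i, y i ∈ F) ∧
      ∀ N, ‖∑ i ∈ Finset.range N, (y i - z)‖ ^ 2 ≤ N * (d * D ^ 2) := by
  have hex : ∀ s : E, ∃ x ∈ F, dualityMap s (x - z) ≤ 0 := by
    intro s
    by_contra! hcon
    have hsub : convexHull ℝ F ⊆ {x | dualityMap s z < dualityMap s x} := by
      refine convexHull_min (fun x hx => ?_)
        (convex_halfSpace_gt (dualityMap s).toLinearMap.isLinear _)
      simpa using hcon x hx
    have : dualityMap s z < dualityMap s z := hsub hz
    exact lt_irrefl _ this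
  choose g hgF hg using hex
  let s : ℕ → E := fun n => Nat.rec 0 (fun _ v => v + (g v - z)) n
  have hs : ∀ n, s n = ∑ i ∈ Finset.range n, (g (s i) - z) := by
    intro n
    induction n with
    | zero => rfl
    | succ n ih => rw [Finset.sum_range_succ, ← ih]
  refine ⟨fun i => g (s i), fun i => hgF _, fun N => ?_⟩
  rw [← hs]
  induction N with
  | zero => simp [s]
  | succ N ih =>
    have h1 := hd (s N) (g (s N) - z)
    have h2 := hg (s N)
    have h3 : d * ‖g (s N) - z‖ ^ 2 ≤ d * D ^ 2 := by
      gcongr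
      exact hD _ (hgF _)
    have h4 : s (N + 1) = s N + (g (s N) - z) := rfl
    rw [h4]
    push_cast
    linarith

/-- Convex combinations of almost fixed points, of any length, are almost fixed: the number `2 ^ m` of
points in the approximating means depends on `ε` only. -/
theorem exists_forall_convexHull_norm_sub_le [UniformConvexSpace E] {d : ℝ}
    (hd : ∀ x y : E, ‖x + y‖ ^ 2 ≤ ‖x‖ ^ 2 + 2 * dualityMap x y + d * ‖y‖ ^ 2) (hd0 : 0 ≤ d)
    {K : Set E} {S : E → E} (hK : Convex ℝ K) (hS : LipschitzOnWith 1 S K) {R : ℝ}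
    (hKR : ∀ x ∈ K, ∀ y ∈ K, ‖x - y‖ ≤ R) {ε : ℝ} (hε : 0 < ε) :
    ∃ δ > 0, ∀ z ∈ convexHull ℝ {x ∈ K | ‖x - S x‖ ≤ δ}, ‖z - S z‖ ≤ ε := by
  -- The mean of `2 ^ m` greedily chosen points is within `√(d R² / 2 ^ m) < ε / 4` of `z`.
  obtain ⟨m, hm⟩ := pow_unbounded_of_one_lt (d * R ^ 2 / (ε / 4) ^ 2) (one_lt_two (α := ℝ))
  obtain ⟨δ, hδ, h⟩ := exists_forall_norm_dyadicMean_sub_le (E := E) R m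
    (show 0 < ε / 2 by positivity)
  refine ⟨δ, hδ, fun z hz => ?_⟩
  have hzK : z ∈ K := convexHull_min (Set.sep_subset _ _) hK hz
  obtain ⟨y, hyF, hy⟩ := exists_seq_norm_sum_sub_sq_le hd hd0 hz (fun x hx => hKR x hx.1 z hzK)
  obtain ⟨hwK, hw⟩ := h K S hK hS hKR y (fun i => (hyF i).1) (fun i => (hyF i).2)
  set w := ((2 ^ m : ℝ)⁻¹ • ∑ i ∈ Finset.range (2 ^ m), y i) with hwdef
  have hpos : (0 : ℝ) < 2 ^ m := by positivity
  have e : w - z = (2 ^ m : ℝ)⁻¹ • ∑ i ∈ Finset.range (2 ^ m), (y i - z) := by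
    rw [Finset.sum_sub_distrib, smul_sub, Finset.sum_const, Finset.card_range,
      ← Nat.cast_smul_eq_nsmul ℝ, smul_smul]
    push_cast
    rw [inv_mul_cancel₀ hpos.ne', one_smul]
  have hwz : ‖w - z‖ ≤ ε / 4 := by
    refine le_of_sq_le_sq ?_ (by positivity)
    have h1 := hy (2 ^ m)
    push_cast at h1
    rw [div_lt_iff₀ (by positivity)] at hm
    rw [e, norm_smul_of_nonneg (by positivity), mul_pow, inv_pow, inv_mul_le_iff₀ (by positivity)]
    nlinarith
  have hSw := hS.norm_sub_le_of_one hwK hzK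
  have e2 : z - S z = -(w - z) + (w - S w) + (S w - S z) := by abel
  calc ‖z - S z‖ ≤ ‖w - z‖ + ‖w - S w‖ + ‖S w - S z‖ := by
        rw [e2]
        refine norm_add₃_le.trans (le_of_eq ?_)
        rw [norm_neg]
    _ ≤ ε := by linarith

/-- Demiclosedness of `I - S` at `0`, with weak limits replaced by points of closed convex hulls. -/
theorem apply_eq_self_of_mem_closure_convexHull [UniformConvexSpace E] {d : ℝ}
    (hd : ∀ x y : E, ‖x + y‖ ^ 2 ≤ ‖x‖ ^ 2 + 2 * dualityMap x y + d * ‖y‖ ^ 2) (hd0 : 0 ≤ d)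
    {K : Set E} {S : E → E} (hK : Convex ℝ K) (hKc : IsClosed K) (hS : LipschitzOnWith 1 S K)
    {R : ℝ} (hKR : ∀ x ∈ K, ∀ y ∈ K, ‖x - y‖ ≤ R) {p : E}
    (hp : ∀ δ > 0, p ∈ closure (convexHull ℝ {x ∈ K | ‖x - S x‖ ≤ δ})) : p ∈ K ∧ S p = p := by
  have hsub : ∀ δ, convexHull ℝ {x ∈ K | ‖x - S x‖ ≤ δ} ⊆ K := fun δ =>
    convexHull_min (Set.sep_subset _ _) hK
  have hpK : p ∈ K := closure_minimal (hsub 1) hKc (hp 1 one_pos)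
  refine ⟨hpK, ?_⟩
  have : ‖p - S p‖ ≤ 0 := by
    refine le_of_forall_pos_le_add fun ε hε => ?_
    obtain ⟨δ, hδ, h⟩ := exists_forall_convexHull_norm_sub_le hd hd0 hK hS hKR
      (show 0 < ε / 3 by positivity)
    obtain ⟨z, hz, hpz⟩ := Metric.mem_closure_iff.1 (hp δ hδ) (ε / 3) (by positivity)
    rw [dist_eq_norm] at hpz
    have h1 := h z hz
    have h2 := hS.norm_sub_le_of_one (hsub δ hz) hpK
    have e : p - S p = (p - z) + (z - S z) + (S z - S p) := by abel
    have h3 : ‖p - S p‖ ≤ ‖p - z‖ + ‖z - S z‖ + ‖S z - S p‖ := by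
      rw [e]; exact norm_add₃_le
    rw [norm_sub_rev z p] at h2
    linarith
  exact (sub_eq_zero.1 (norm_le_zero_iff.1 this)).symm

/-- A nonexpansive map that fixes `p` and hardly decreases the distance from `x` to `p` is almost affine
on the segment from `x` to `p`, with a `δ` that does not depend on the map. -/
theorem exists_forall_norm_apply_convexCombo_sub_le [UniformConvexSpace E] {l : ℝ} (hl : 0 < l)
    (hl2 : l ≤ 1 / 2) {ε : ℝ} (hε : 0 < ε) (R : ℝ) :
    ∃ δ > 0, ∀ (C : Set E) (V : E → E), Convex ℝ C → LipschitzOnWith 1 V C →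
      ∀ x ∈ C, ∀ p ∈ C, V p = p → ‖x - p‖ ≤ R → ‖x - p‖ - δ < ‖V x - p‖ →
        ‖V (l • x + (1 - l) • p) - (l • V x + (1 - l) • p)‖ ≤ ε := by
  obtain ⟨η, hη, h⟩ := exists_forall_norm_convexCombo_le_sub (E := E) hε R hl hl2
  refine ⟨η, hη, fun C V hC hV x hx p hp hVp hR hδ => ?_⟩
  have hl1 : 0 < 1 - l := by linarith
  set u := l • x + (1 - l) • p with hu
  have huC : u ∈ C := hC hx hp hl.le hl1.le (by ring)
  -- `V x - p` is the convex combination `l • a + (1 - l) • b` of vectors of norm at most `‖x - p‖`;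
  -- as it is nearly that long itself, `a` and `b` are close.
  set a := l⁻¹ • (V u - p) with ha
  set b := (1 - l)⁻¹ • (V x - V u) with hb
  have hla : l • a = V u - p := smul_inv_smul₀ hl.ne' _
  have hlb : (1 - l) • b = V x - V u := smul_inv_smul₀ hl1.ne' _
  have han : ‖a‖ ≤ ‖x - p‖ := by
    have h1 := hV.norm_sub_le_of_one huC hp
    rw [hVp, show u - p = l • (x - p) by rw [hu]; module, ← hla, norm_smul_of_nonneg hl.le,
      norm_smul_of_nonneg hl.le] at h1
    exact le_of_mul_le_mul_left h1 hl
  have hbn : ‖b‖ ≤ ‖x - p‖ := by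
    have h1 := hV.norm_sub_le_of_one hx huC
    rw [show x - u = (1 - l) • (x - p) by rw [hu]; module, ← hlb, norm_smul_of_nonneg hl1.le,
      norm_smul_of_nonneg hl1.le] at h1
    exact le_of_mul_le_mul_left h1 hl1
  have hab : ‖a - b‖ < ε := by
    by_contra! hcon
    have h1 := h _ hR a b han hbn hcon
    rw [hla, hlb, add_comm, sub_add_sub_cancel] at h1
    linarith
  have e : V u - (l • V x + (1 - l) • p) = (l * (1 - l)) • (a - b) := by
    have e1 : (l * (1 - l)) • (a - b) = (1 - l) • (l • a) - l • ((1 - l) • b) := by module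
    rw [e1, hla, hlb]
    module
  rw [e, norm_smul_of_nonneg (by positivity)]
  have h1 : l * (1 - l) ≤ 1 := by nlinarith
  exact (mul_le_of_le_one_left (norm_nonneg _) h1).trans hab.le

/-- `2 j(x)` is a subgradient of `‖·‖ ^ 2` at `x`. -/
theorem two_mul_dualityMap_le (x y : E) : ‖x‖ ^ 2 + 2 * dualityMap x y ≤ ‖x + y‖ ^ 2 := by
  obtain ⟨h1, h2⟩ := dualityMap_mem x
  have h3 := (le_abs_self _).trans ((dualityMap x).le_opNorm (x + y))
  rw [map_add, h1, h2] at h3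
  nlinarith [sq_nonneg (‖x‖ - ‖x + y‖)]

end Nonexpansive

/-! ### Weak convergence of orbits under nonexpansive maps -/

section Reich

/-- An almost decreasing sequence that is bounded below is Cauchy. -/
theorem cauchySeq_of_forall_le_add {a : ℕ → ℝ} (hb : ∀ n, 0 ≤ a n)
    (h : ∀ ε > 0, ∃ N, ∀ n ≥ N, ∀ m ≥ n, a m ≤ a n + ε) : CauchySeq a := by
  rw [Metric.cauchySeq_iff']
  intro ε hε
  obtain ⟨N, hN⟩ := h (ε / 3) (by positivity)
  have hbdd : BddBelow (a '' Set.Ici N) := ⟨0, by rintro _ ⟨n, -, rfl⟩; exact hb n⟩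
  obtain ⟨_, ⟨n₀, hn₀, rfl⟩, hlt⟩ := exists_lt_of_csInf_lt (s := a '' Set.Ici N)
    ⟨_, N, Set.self_mem_Ici, rfl⟩ (show sInf (a '' Set.Ici N) < sInf (a '' Set.Ici N) + ε / 3 by
      linarith)
  refine ⟨n₀, fun m hm => ?_⟩
  have h1 := hN n₀ hn₀ m hm
  have h2 : sInf (a '' Set.Ici N) ≤ a m := csInf_le hbdd ⟨m, le_trans hn₀ hm, rfl⟩
  rw [Real.dist_eq, abs_lt]
  constructor <;> linarith

variable {E : Type*} [NormedAddCommGroup E] {C F : Set E} {x : ℕ → E}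

/-- Any earlier term of `x` is carried to any later one by a nonexpansive self-map of `C` that fixes
all points of `F`. The map may depend on the two indices; its values outside `C` and `F`
do not matter. -/
def IsNonexpansiveOrbit (C F : Set E) (x : ℕ → E) : Prop :=
  ∀ n m, n ≤ m → ∃ V : E → E, Set.MapsTo V C C ∧ LipschitzOnWith 1 V C ∧
    (∀ p ∈ F, V p = p) ∧ V (x n) = x m

theorem IsNonexpansiveOrbit.norm_sub_le (h : IsNonexpansiveOrbit C F x) (hxC : ∀ n, x n ∈ C)
    (hFC : F ⊆ C) {p : E} (hp : p ∈ F) {n m : ℕ} (hnm : n ≤ m) : ‖x m - p‖ ≤ ‖x n - p‖ := by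
  obtain ⟨V, -, hV, hVF, hVx⟩ := h n m hnm
  have := hV.norm_sub_le_of_one (hxC n) (hFC hp)
  rwa [hVx, hVF p hp] at this

variable [NormedSpace ℝ E]

/-- If `V` carries `x n` to a later `x m`, then `l • x m + (1 - l) • p` is close to
`V (l • x n + (1 - l) • p)`, which is no farther from `q` than `l • x n + (1 - l) • p` is. -/
theorem IsNonexpansiveOrbit.cauchySeq_norm_convexCombo_sub [UniformConvexSpace E]
    (h : IsNonexpansiveOrbit C F x) (hC : Convex ℝ C) (hxC : ∀ n, x n ∈ C) (hFC : F ⊆ C)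
    {p q : E} (hp : p ∈ F) (hq : q ∈ F) {l : ℝ} (hl : 0 < l) (hl2 : l ≤ 1 / 2) :
    CauchySeq fun n => ‖l • x n + (1 - l) • p - q‖ := by
  have hmono : Antitone fun n => ‖x n - p‖ := fun n m hnm => h.norm_sub_le hxC hFC hp hnm
  have hcau : CauchySeq fun n => ‖x n - p‖ :=
    (tendsto_atTop_ciInf hmono ⟨0, by rintro _ ⟨n, rfl⟩; exact norm_nonneg _⟩).cauchySeq
  refine cauchySeq_of_forall_le_add (fun n => norm_nonneg _) fun ε hε => ?_
  obtain ⟨δ, hδ, hV⟩ := exists_forall_norm_apply_convexCombo_sub_le (E := E) hl hl2 hε ‖x 0 - p‖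
  obtain ⟨N, hN⟩ := Metric.cauchySeq_iff.1 hcau δ hδ
  refine ⟨N, fun n hn m hm => ?_⟩
  obtain ⟨V, -, hVl, hVF, hVx⟩ := h n m hm
  have h1 := hV C V hC hVl (x n) (hxC n) p (hFC hp) (hVF p hp) (hmono (Nat.zero_le n)) (by
    have := (abs_lt.1 (hN n hn m (le_trans hn hm))).2
    rw [hVx]; linarith)
  rw [hVx] at h1
  have h2 := hVl.norm_sub_le_of_one
    (hC (hxC n) (hFC hp) hl.le (by linarith : 0 ≤ 1 - l) (by ring)) (hFC hq)
  rw [hVF q hq] at h2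
  rw [norm_sub_rev] at h1
  linarith [norm_sub_le_norm_sub_add_norm_sub (l • x m + (1 - l) • p)
    (V (l • x n + (1 - l) • p)) q]

theorem IsNonexpansiveOrbit.cauchySeq_dualityMap [UniformConvexSpace E] {d : ℝ} (hd0 : 0 ≤ d)
    (hd : ∀ x y : E, ‖x + y‖ ^ 2 ≤ ‖x‖ ^ 2 + 2 * dualityMap x y + d * ‖y‖ ^ 2)
    (h : IsNonexpansiveOrbit C F x) (hC : Convex ℝ C) (hxC : ∀ n, x n ∈ C) (hFC : F ⊆ C)
    {p q : E} (hp : p ∈ F) (hq : q ∈ F) :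
    CauchySeq fun n => dualityMap (p - q) (x n - p) := by
  rw [Metric.cauchySeq_iff]
  intro ε hε
  -- `l` is so small that the quadratic error term costs at most `ε / 2` after division by `2 * l`.
  set D := d * ‖x 0 - p‖ ^ 2 with hD
  have hD0 : 0 ≤ D := by positivity
  set l := min (1 / 2) (ε / (D + 1)) with hl
  have hl0 : 0 < l := by positivity
  have hl2 : l ≤ 1 / 2 := min_le_left _ _
  have hlD : l * D ≤ ε := by
    have : l ≤ ε / (D + 1) := min_le_right _ _
    rw [le_div_iff₀ (by positivity)] at this
    nlinarith
  obtain ⟨L, hL⟩ := cauchySeq_tendsto_of_complete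
    (h.cauchySeq_norm_convexCombo_sub hC hxC hFC hp hq hl0 hl2)
  obtain ⟨N, hN⟩ := Metric.cauchySeq_iff.1 (hL.pow 2).cauchySeq (l * ε) (by positivity)
  -- The difference quotient of `‖·‖ ^ 2` at `p - q` is within `O(l)` of the duality map.
  have hup : ∀ n, ‖l • x n + (1 - l) • p - q‖ ^ 2 ≤
      ‖p - q‖ ^ 2 + 2 * (l * dualityMap (p - q) (x n - p)) + l * (l * D) := fun n => by
    have h1 := hd (p - q) (l • (x n - p))
    rw [show p - q + l • (x n - p) = l • x n + (1 - l) • p - q by module, map_smul, smul_eq_mul,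
      norm_smul_of_nonneg hl0.le, mul_pow] at h1
    have h2 : d * (l ^ 2 * ‖x n - p‖ ^ 2) ≤ l * (l * D) := by
      have h3 : d * (l ^ 2 * ‖x n - p‖ ^ 2) ≤ d * (l ^ 2 * ‖x 0 - p‖ ^ 2) := by
        gcongr
        exact h.norm_sub_le hxC hFC hp (Nat.zero_le n)
      refine h3.trans (le_of_eq ?_)
      rw [hD]; ring
    linarith
  have hlow : ∀ n, ‖p - q‖ ^ 2 + 2 * (l * dualityMap (p - q) (x n - p)) ≤
      ‖l • x n + (1 - l) • p - q‖ ^ 2 := fun n => by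
    have h1 := two_mul_dualityMap_le (p - q) (l • (x n - p))
    rwa [show p - q + l • (x n - p) = l • x n + (1 - l) • p - q by module, map_smul,
      smul_eq_mul] at h1
  refine ⟨N, fun m hm n hn => ?_⟩
  have h1 := abs_lt.1 (hN m hm n hn)
  have hlε : l * (l * D) ≤ l * ε := by gcongr
  rw [Real.dist_eq, abs_lt]
  constructor
  · refine lt_of_mul_lt_mul_left ?_ hl0.le
    linarith [hup m, hlow n]
  · refine lt_of_mul_lt_mul_left ?_ hl0.le
    linarith [hup n, hlow m]

/-- Reich's theorem, with Fréchet differentiability of the norm replaced by the quantitative smoothness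
inequality `hd`. -/
theorem IsNonexpansiveOrbit.exists_tendsto_weak [CompleteSpace E] [UniformConvexSpace E] {d : ℝ}
    (hd0 : 0 ≤ d)
    (hd : ∀ x y : E, ‖x + y‖ ^ 2 ≤ ‖x‖ ^ 2 + 2 * dualityMap x y + d * ‖y‖ ^ 2)
    {S : E → E} (h : IsNonexpansiveOrbit C {p ∈ C | S p = p} x) (hC : Convex ℝ C)
    (hCc : IsClosed C) (hxC : ∀ n, x n ∈ C) (hS : LipschitzOnWith 1 S C)
    (hfix : ∃ p ∈ C, S p = p) (hres : Tendsto (fun n => ‖x n - S (x n)‖) atTop (𝓝 0)) :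
    ∃ p ∈ C, S p = p ∧ Tendsto (fun n => toWeakSpace ℝ E (x n)) atTop (𝓝 (toWeakSpace ℝ E p)) := by
  have hFC : {p ∈ C | S p = p} ⊆ C := Set.sep_subset _ _
  obtain ⟨p₀, hp₀C, hp₀⟩ := hfix
  set K := C ∩ Metric.closedBall p₀ ‖x 0 - p₀‖ with hK
  have hKconv : Convex ℝ K := hC.inter (convex_closedBall _ _)
  have hKR : ∀ y ∈ K, ∀ z ∈ K, ‖y - z‖ ≤ 2 * ‖x 0 - p₀‖ := fun y hy z hz => by
    rw [← dist_eq_norm, two_mul]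
    exact (dist_triangle_right y z p₀).trans (add_le_add hy.2 hz.2)
  have hxK : ∀ n, x n ∈ K := fun n => ⟨hxC n, by
    rw [Metric.mem_closedBall, dist_eq_norm]
    exact h.norm_sub_le hxC hFC ⟨hp₀C, hp₀⟩ (Nat.zero_le n)⟩
  have hxM : ∀ n, ‖x n‖ ≤ ‖x 0 - p₀‖ + ‖p₀‖ := fun n => by
    have h1 := h.norm_sub_le hxC hFC ⟨hp₀C, hp₀⟩ (Nat.zero_le n)
    linarith [norm_sub_norm_le (x n) p₀]
  have hlim : ∀ U : Ultrafilter ℕ, (U : Filter ℕ) ≤ atTop → ∃ p ∈ {p ∈ C | S p = p},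
      ∀ f : StrongDual ℝ E, Tendsto (fun n => f (x n)) U (𝓝 (f p)) := fun U hU => by
    obtain ⟨p, hp⟩ := exists_forall_mem_closure_convexHull_image (U : Filter ℕ) hxM
    obtain ⟨hpK, hSp⟩ := apply_eq_self_of_mem_closure_convexHull hd hd0 hKconv
      (hCc.inter Metric.isClosed_closedBall) (hS.mono Set.inter_subset_left) hKR (p := p) (by
        intro δ hδ
        refine closure_mono (convexHull_mono ?_) (hp {n | ‖x n - S (x n)‖ ≤ δ} (hU ?_))
        · rintro _ ⟨n, hn, rfl⟩
          exact ⟨hxK n, hn⟩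
        · exact (hres.eventually (gt_mem_nhds hδ)).mono fun n hn => le_of_lt hn)
    exact ⟨p, ⟨hpK.1, hSp⟩, tendsto_of_mem_closure_convexHull_image U hp⟩
  have huniq : ∀ U U' : Ultrafilter ℕ, (U : Filter ℕ) ≤ atTop → (U' : Filter ℕ) ≤ atTop →
      ∀ p ∈ {p ∈ C | S p = p}, ∀ q ∈ {p ∈ C | S p = p},
      (∀ f : StrongDual ℝ E, Tendsto (fun n => f (x n)) U (𝓝 (f p))) →
      (∀ f : StrongDual ℝ E, Tendsto (fun n => f (x n)) U' (𝓝 (f q))) → p = q := by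
    intro U U' hU hU' p hp q hq hUp hUq
    obtain ⟨L, hL⟩ := cauchySeq_tendsto_of_complete
      (h.cauchySeq_dualityMap hd0 hd hC hxC hFC hp hq)
    simp only [map_sub (dualityMap (p - q))] at hL
    have h1 := tendsto_nhds_unique (hL.mono_left hU) ((hUp (dualityMap (p - q))).sub_const _)
    have h2 := tendsto_nhds_unique (hL.mono_left hU') ((hUq (dualityMap (p - q))).sub_const _)
    have h3 := (dualityMap_mem (p - q)).1
    rw [map_sub] at h3
    have h4 : ‖p - q‖ ^ 2 = 0 := by linarith
    exact sub_eq_zero.1 (norm_eq_zero.1 (pow_eq_zero_iff two_ne_zero |>.1 h4))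
  obtain ⟨p, hp, hpU⟩ := hlim (Ultrafilter.of atTop) (Ultrafilter.of_le _)
  refine ⟨p, hp.1, hp.2, ?_⟩
  refine (WeakBilin.tendsto_iff_forall_eval_tendsto _ ?_).2 fun f => ?_
  · intro y z hyz
    exact (SeparatingDual.eq_iff_forall_dual_eq (R := ℝ) (V := E)).2 fun g =>
      LinearMap.congr_fun hyz g
  · refine tendsto_iff_ultrafilter _ _ _ |>.2 fun U hU => ?_
    obtain ⟨q, hq, hqU⟩ := hlim U hU
    rw [huniq _ U (Ultrafilter.of_le _) hU p hp q hq hpU hqU]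
    exact hqU f

end Reich

/-! ### Relaxations of strict pseudocontractions and the Mann iteration -/

section Mann

variable {E : Type*} [NormedAddCommGroup E] [NormedSpace ℝ E] {C : Set E} {T : E → E} {d k : ℝ}

theorem IsStrictPseudocontractionOn.norm_relaxation_sub_sq_le (hd1 : 1 ≤ d)
    (hd : ∀ x y : E, ‖x + y‖ ^ 2 ≤ ‖x‖ ^ 2 + 2 * dualityMap x y + d * ‖y‖ ^ 2)
    (hT : IsStrictPseudocontractionOn k T C) {t : ℝ} (ht : 0 ≤ t) {x y : E} (hx : x ∈ C)
    (hy : y ∈ C) :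
    ‖(t • T x + (1 - t) • x) - (t • T y + (1 - t) • y)‖ ^ 2 ≤
      ‖x - y‖ ^ 2 - d * (t * ((1 - k) / d - t)) * ‖(x - T x) - (y - T y)‖ ^ 2 := by
  have h1 := hd (x - y) (-(t • ((x - T x) - (y - T y))))
  have h2 := mul_le_mul_of_nonneg_left (hT x hx y hy) ht
  rw [show x - y + -(t • ((x - T x) - (y - T y))) =
    (t • T x + (1 - t) • x) - (t • T y + (1 - t) • y) by module, map_neg, map_smul, smul_eq_mul,
    norm_neg, norm_smul_of_nonneg ht, mul_pow] at h1
  have h3 : d * (t * ((1 - k) / d - t)) = t * (1 - k) - d * t ^ 2 := by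
    field_simp
  rw [h3]
  linarith

theorem IsStrictPseudocontractionOn.lipschitzOnWith_relaxation (hd1 : 1 ≤ d)
    (hd : ∀ x y : E, ‖x + y‖ ^ 2 ≤ ‖x‖ ^ 2 + 2 * dualityMap x y + d * ‖y‖ ^ 2)
    (hT : IsStrictPseudocontractionOn k T C) {t : ℝ} (ht : 0 ≤ t) (htk : t ≤ (1 - k) / d) :
    LipschitzOnWith 1 (fun x => t • T x + (1 - t) • x) C := by
  refine LipschitzOnWith.of_dist_le_mul fun x hx y hy => ?_
  rw [dist_eq_norm, dist_eq_norm, NNReal.coe_one, one_mul]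
  refine le_of_sq_le_sq ((hT.norm_relaxation_sub_sq_le hd1 hd ht hx hy).trans ?_) (norm_nonneg _)
  have : 0 ≤ (1 - k) / d - t := by linarith
  have : 0 ≤ d * (t * ((1 - k) / d - t)) * ‖(x - T x) - (y - T y)‖ ^ 2 := by positivity
  linarith

theorem mapsTo_relaxation (hC : Convex ℝ C) (hTC : Set.MapsTo T C C) {t : ℝ} (ht : 0 ≤ t)
    (ht1 : t ≤ 1) : Set.MapsTo (fun x => t • T x + (1 - t) • x) C C := fun x hx =>
  hC (hTC hx) hx ht (by linarith) (by ring)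

/-- A Krasnoselskii-Mann step does not increase the residual. -/
theorem norm_sub_apply_convexCombo_le {S : E → E} (hS : LipschitzOnWith 1 S C) {s : ℝ}
    (hs : 0 ≤ s) (hs1 : s ≤ 1) {x : E} (hx : x ∈ C) (hy : s • S x + (1 - s) • x ∈ C) :
    ‖(s • S x + (1 - s) • x) - S (s • S x + (1 - s) • x)‖ ≤ ‖x - S x‖ := by
  set y := s • S x + (1 - s) • x with hydef
  have h1 := hS.norm_sub_le_of_one hx hy
  rw [show x - y = s • (x - S x) by rw [hydef]; module, norm_smul_of_nonneg hs] at h1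
  have e : y - S y = (1 - s) • (x - S x) + (S x - S y) := by rw [hydef]; module
  calc ‖y - S y‖ ≤ (1 - s) * ‖x - S x‖ + ‖S x - S y‖ := by
        rw [e]
        refine (norm_add_le _ _).trans (le_of_eq ?_)
        rw [norm_smul_of_nonneg (by linarith)]
    _ ≤ ‖x - S x‖ := by linarith

variable {t : ℕ → ℝ} {x : E}

theorem mannIteration_mem (hC : Convex ℝ C) (hTC : Set.MapsTo T C C) (hx : x ∈ C)
    (ht : ∀ n, t n ∈ Set.Icc (0 : ℝ) 1) (n : ℕ) : mannIteration T t x n ∈ C := by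
  induction n with
  | zero => exact hx
  | succ n ih => exact mapsTo_relaxation hC hTC (ht n).1 (ht n).2 ih

theorem isNonexpansiveOrbit_mannIteration (hC : Convex ℝ C) (hTC : Set.MapsTo T C C)
    (ht : ∀ n, t n ∈ Set.Icc (0 : ℝ) 1)
    (hlip : ∀ n, LipschitzOnWith 1 (fun x => t n • T x + (1 - t n) • x) C) :
    IsNonexpansiveOrbit C {p ∈ C | T p = p} (mannIteration T t x) := by
  intro n m hnm
  induction m, hnm using Nat.le_induction with
  | base => exact ⟨id, Set.mapsTo_id C, LipschitzWith.id.lipschitzOnWith, fun _ _ => rfl, rfl⟩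
  | succ m _ ih =>
    obtain ⟨V, hVC, hV, hVF, hVx⟩ := ih
    refine ⟨fun y => t m • T (V y) + (1 - t m) • V y, fun y hy =>
      mapsTo_relaxation hC hTC (ht m).1 (ht m).2 (hVC hy), ?_, fun p hp => ?_, ?_⟩
    · have := (hlip m).comp hV hVC
      rwa [mul_one] at this
    · simp only [hVF p hp, hp.2]
      module
    · simp only [hVx]
      rfl

theorem tendsto_norm_mannIteration_sub_apply (hd1 : 1 ≤ d)
    (hd : ∀ x y : E, ‖x + y‖ ^ 2 ≤ ‖x‖ ^ 2 + 2 * dualityMap x y + d * ‖y‖ ^ 2)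
    (hT : IsStrictPseudocontractionOn k T C) (hk1 : k < 1) {p : E} (hp : p ∈ C) (hTp : T p = p)
    (hxC : ∀ n, mannIteration T t x n ∈ C) (ht : ∀ n, t n ∈ Set.Ioo 0 ((1 - k) / d))
    (hsum : Tendsto (fun N => ∑ n ∈ Finset.range N, t n * ((1 - k) / d - t n)) atTop atTop) :
    Tendsto (fun n => ‖mannIteration T t x n - T (mannIteration T t x n)‖) atTop (𝓝 0) := by
  set y := mannIteration T t x with hy
  have hd0 : 0 < d := by linarith
  set b := (1 - k) / d with hb
  have hb0 : 0 < b := div_pos (by linarith) hd0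
  -- The residuals of `T` are those of its relaxation with parameter `b`, up to the factor `b`.
  have hSb := hT.lipschitzOnWith_relaxation hd1 hd hb0.le le_rfl
  have hanti : Antitone fun n => ‖y n - T (y n)‖ := by
    refine antitone_nat_of_succ_le fun n => ?_
    have e : (t n / b) • (b • T (y n) + (1 - b) • y n) + (1 - t n / b) • y n = y (n + 1) := by
      have : y (n + 1) = t n • T (y n) + (1 - t n) • y n := rfl
      rw [this, show t n = t n / b * b by field_simp]
      rw [mul_div_assoc, div_self hb0.ne', mul_one]
      module
    have h1 := norm_sub_apply_convexCombo_le hSb (div_nonneg (ht n).1.le hb0.le)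
      ((div_le_one hb0).2 (ht n).2.le) (hxC n) (by rw [e]; exact hxC (n + 1))
    have h2 : ∀ v, v - (b • T v + (1 - b) • v) = b • (v - T v) := fun v => by module
    simp only [e, h2, norm_smul_of_nonneg hb0.le] at h1
    exact le_of_mul_le_mul_left h1 hb0
  have hstep : ∀ n, d * (t n * (b - t n)) * ‖y n - T (y n)‖ ^ 2 ≤
      ‖y n - p‖ ^ 2 - ‖y (n + 1) - p‖ ^ 2 := fun n => by
    have h1 := hT.norm_relaxation_sub_sq_le hd1 hd (ht n).1.le (hxC n) hp
    rw [hTp, sub_self, sub_zero, show t n • p + (1 - t n) • p = p by module] at h1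
    have h2 : y (n + 1) = t n • T (y n) + (1 - t n) • y n := rfl
    rw [h2]
    linarith
  rw [Metric.tendsto_atTop]
  intro ε hε
  obtain ⟨n, hn⟩ : ∃ n, ‖y n - T (y n)‖ < ε := by
    by_contra! hcon
    have hbound : ∀ N, d * ε ^ 2 * ∑ n ∈ Finset.range N, t n * (b - t n) ≤ ‖y 0 - p‖ ^ 2 :=
      fun N => by
      calc d * ε ^ 2 * ∑ n ∈ Finset.range N, t n * (b - t n)
          ≤ ∑ n ∈ Finset.range N, (‖y n - p‖ ^ 2 - ‖y (n + 1) - p‖ ^ 2) := by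
            rw [Finset.mul_sum]
            refine Finset.sum_le_sum fun n _ => le_trans ?_ (hstep n)
            have h1 : 0 ≤ d * (t n * (b - t n)) :=
              mul_nonneg hd0.le (mul_nonneg (ht n).1.le (sub_nonneg.2 (ht n).2.le))
            have h2 : ε ^ 2 ≤ ‖y n - T (y n)‖ ^ 2 := by gcongr; exact hcon n
            linarith [mul_le_mul_of_nonneg_left h2 h1]
        _ = ‖y 0 - p‖ ^ 2 - ‖y N - p‖ ^ 2 := Finset.sum_range_sub' _ _
        _ ≤ ‖y 0 - p‖ ^ 2 := sub_le_self _ (sq_nonneg _)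
    obtain ⟨N, hN⟩ := (hsum.const_mul_atTop (show 0 < d * ε ^ 2 by positivity)).eventually
      (eventually_gt_atTop (‖y 0 - p‖ ^ 2)) |>.exists
    exact (hbound N).not_gt hN
  refine ⟨n, fun m hm => ?_⟩
  rw [Real.dist_eq, sub_zero, abs_of_nonneg (norm_nonneg _)]
  exact (hanti hm).trans_lt hn

end Mann

theorem theorem3 {E : Type*} [NormedAddCommGroup E] [NormedSpace ℝ E] [CompleteSpace E]
    [UniformConvexSpace E] (hE : IsTwoUniformlySmooth E)
    (C : Set E) (hCconvex : Convex ℝ C) (hCclosed : IsClosed C)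
    (T : E → E) (hTC : Set.MapsTo T C C)
    (d : ℝ) (hd1 : 1 ≤ d)
    (hd : ∀ x y : E, ‖x + y‖ ^ 2 ≤ ‖x‖ ^ 2 + 2 * dualityMap x y + d * ‖y‖ ^ 2)
    (k : ℝ) (hk0 : 0 < k) (hk1 : k < 1)
    (hT : IsStrictPseudocontractionOn k T C)
    (hfix : ∃ p ∈ C, T p = p)
    (x : E) (hx : x ∈ C)
    (t : ℕ → ℝ) (ht : ∀ n, t n ∈ Set.Ioo 0 ((1 - k) / d))
    (hsum : Tendsto (fun N => ∑ n ∈ Finset.range N, t n * ((1 - k) / d - t n)) atTop atTop) :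
    ∃ p ∈ C, T p = p ∧
      Tendsto (fun n => toWeakSpace ℝ E (mannIteration T t x n)) atTop
        (𝓝 (toWeakSpace ℝ E p)) := by
  have hd0 : 0 < d := by linarith
  set b := (1 - k) / d with hb
  have hb0 : 0 < b := div_pos (by linarith) hd0
  have hb1 : b ≤ 1 := (div_le_one hd0).2 (by linarith)
  have ht' : ∀ n, t n ∈ Set.Icc (0 : ℝ) 1 := fun n => ⟨(ht n).1.le, (ht n).2.le.trans hb1⟩
  have hxC := mannIteration_mem hCconvex hTC hx ht'
  have horbit := isNonexpansiveOrbit_mannIteration (x := x) hCconvex hTC ht'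
    fun n => hT.lipschitzOnWith_relaxation hd1 hd (ht n).1.le (ht n).2.le
  obtain ⟨p₀, hp₀, hTp₀⟩ := hfix
  have hres := tendsto_norm_mannIteration_sub_apply hd1 hd hT hk1 hp₀ hTp₀ hxC ht hsum
  -- The largest admissible relaxation of `T` is nonexpansive and has the same fixed points.
  have hsub : ∀ v, v - (b • T v + (1 - b) • v) = b • (v - T v) := fun v => by module
  have hfixed : ∀ v, b • T v + (1 - b) • v = v ↔ T v = v := fun v => by
    rw [eq_comm, ← sub_eq_zero, hsub, smul_eq_zero_iff_right hb0.ne', sub_eq_zero, eq_comm]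
  obtain ⟨p, hpC, hp, hlim⟩ := IsNonexpansiveOrbit.exists_tendsto_weak hd0.le hd
    (S := fun v => b • T v + (1 - b) • v) (by simpa only [hfixed] using horbit) hCconvex hCclosed
    hxC (hT.lipschitzOnWith_relaxation hd1 hd hb0.le le_rfl) ⟨p₀, hp₀, (hfixed p₀).2 hTp₀⟩
    (by simpa only [hsub, norm_smul_of_nonneg hb0.le, mul_zero] using hres.const_mul b)
  exact ⟨p, hpC, (hfixed p).1 hp, hlim⟩
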